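/- For integers $N\ge 1$ let $E_{ij}$ ($1\le i,j\le N$) be the matrix units of $\mathfrak{gl}(N)$ over $\mathbb C$. For a permutation $\alpha\in\mathbb S_m$ ($m\ge 0$) put $$w_{\mathfrak{gl}(N)}(\alpha)=\sum_{i_1,\dots,i_m=1}^N E_{i_1i_{\alpha(1)}}E_{i_2i_{\alpha(2)}}\cdots E_{i_mi_{\alpha(m)}}\in U\mathfrak{gl}(N).$$ For $m\ge 1$ let $C_m=w_{\mathfrak{gl}(N)}((1,2,\dots,m))$ be the Casimir elements; they lie in the center of $U\mathfrak{gl}(N)$. Let $w_{\mathfrak{gl}}(\alpha)\in\mathbb C[N][C_1,C_2,\dots]$ be the universal $\mathfrak{gl}$-weight system, that is, the polynomial which, for every $N=1,2,\dots$, becomes $w_{\mathfrak{gl}(N)}(\alpha)$ when the variable $N$ is replaced by the number $N$ and the variables $C_1,C_2,\dots$ by the Casimir elements of $U\mathfrak{gl}(N)$. A chord diagram $B$ with $n$ chords is presented as a fixed-point-free involution $\alpha_B$ of its $2n$ chord ends, numbered $1,\dots,2n$ in cyclic order along the oriented circle from an arbitrary starting point; put $w_{\mathfrak{gl}}(B)=w_{\mathfrak{gl}}(\alpha_B)$.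 The intersection graph $\gamma(B)$ has the chords of $B$ as vertices, two of them being adjacent if and only if the chords intersect (their ends alternate). **Lemma.** (1) For every $m\ge 0$ and every permutation $\alpha\in\mathbb S_m$, the substitution $C_k:=N$ for all $k=1,2,3,\dots$ in $w_{\mathfrak{gl}}(\alpha)$ gives the monomial $N^{c(\alpha)}\in\mathbb C[N]$, where $c(\alpha)$ is the number of cycles of $\alpha$ (fixed points included). (2) For intersection graphs of chord diagrams, the graph invariant $G\mapsto N^{|V(G)|}$ is induced from the $\mathfrak{gl}$-weight system under the substitution $C_k:=N$, $k=1,2,3,\dots$: for every chord diagram $B$, this substitution in $w_{\mathfrak{gl}}(B)$ gives $N^{|V(\gamma(B))|}$. -/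

import Mathlib

open Polynomial

attribute [local instance] LieRing.ofAssociativeRing

namespace GlWeight

/-! ### The universal enveloping algebra of `gl(N)` and the `gl(N)`-weight system -/

/-- The universal enveloping algebra `U gl(N)` over `ℂ`, where `gl(N)` is the Lie algebra of
`N × N` matrices with the commutator bracket. -/
abbrev Ugl (N : ℕ) : Type := UniversalEnvelopingAlgebra ℂ (Matrix (Fin N) (Fin N) ℂ)

/-- The matrix unit `E_{ij}`, as an element of `U gl(N)`. -/
noncomputable def E (N : ℕ) (i j : Fin N) : Ugl N :=
  UniversalEnvelopingAlgebra.ι ℂ (Matrix.single i j (1 : ℂ))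

/-- The `gl(N)`-weight system on permutations `α ∈ S_m`:
`w_{gl(N)}(α) = ∑_{i_1, …, i_m = 1}^N E_{i_1 i_{α(1)}} ⋯ E_{i_m i_{α(m)}} ∈ U gl(N)`. -/
noncomputable def wglN (N : ℕ) {m : ℕ} (α : Equiv.Perm (Fin m)) : Ugl N :=
  ∑ i : Fin m → Fin N, (List.ofFn fun k => E N (i k) (i (α k))).prod

/-- The Casimir element `C_m = w_{gl(N)}((1,2,…,m)) ∈ U gl(N)`. -/
noncomputable def casimir (N m : ℕ) : Ugl N := wglN N (finRotate m)

/-! ### Casimir elements are central -/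

theorem E_mul_E (N : ℕ) (a b c d : Fin N) :
    E N a b * E N c d = E N c d * E N a b
      + (if b = c then E N a d else 0) - (if d = a then E N c b else 0) := by
  have h : ⁅E N a b, E N c d⁆
      = (if b = c then E N a d else 0) - (if d = a then E N c b else 0) := by
    unfold E
    rw [← LieHom.map_lie, Ring.lie_def]
    by_cases h1 : b = c <;> by_cases h2 : d = a
    · subst h1; subst h2; simp
    · subst h1; simp [h2, Matrix.single_mul_single_of_ne]
    · subst h2; simp [h1, Matrix.single_mul_single_of_ne]
    · simp [h1, h2, Matrix.single_mul_single_of_ne]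
  rw [Ring.lie_def] at h
  rw [add_sub_assoc, ← h]; abel

theorem mem_center_of_commute (N : ℕ) (x : Ugl N)
    (h : ∀ a b, E N a b * x = x * E N a b) : x ∈ Subalgebra.center ℂ (Ugl N) := by
  have hι : ∀ A : Matrix (Fin N) (Fin N) ℂ,
      UniversalEnvelopingAlgebra.ι ℂ A ∈ Subalgebra.centralizer ℂ ({x} : Set (Ugl N)) := by
    intro A
    rw [Subalgebra.mem_centralizer_iff]
    rintro _ rfl
    rw [Matrix.matrix_eq_sum_single A]
    simp only [map_sum, Finset.mul_sum, Finset.sum_mul]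
    refine Finset.sum_congr rfl fun i _ => Finset.sum_congr rfl fun j _ => ?_
    have : Matrix.single i j (A i j) = A i j • Matrix.single i j (1 : ℂ) := by simp
    rw [this, map_smul, mul_smul_comm, smul_mul_assoc]
    exact congrArg _ (h i j).symm
  let S := Subalgebra.centralizer ℂ ({x} : Set (Ugl N))
  let g : Matrix (Fin N) (Fin N) ℂ →ₗ⁅ℂ⁆ S :=
    { toFun := fun A => ⟨UniversalEnvelopingAlgebra.ι ℂ A, hι A⟩
      map_add' := fun A B => Subtype.ext (by simp)
      map_smul' := fun c A => Subtype.ext (by simp)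
      map_lie' := fun {A B} => Subtype.ext (by
        change UniversalEnvelopingAlgebra.ι ℂ ⁅A, B⁆ = UniversalEnvelopingAlgebra.ι ℂ A *
          UniversalEnvelopingAlgebra.ι ℂ B - UniversalEnvelopingAlgebra.ι ℂ B *
          UniversalEnvelopingAlgebra.ι ℂ A
        rw [LieHom.map_lie, Ring.lie_def]) }
  have hid : S.val.comp (UniversalEnvelopingAlgebra.lift ℂ g) = AlgHom.id ℂ (Ugl N) := by
    apply UniversalEnvelopingAlgebra.hom_ext
    ext A
    simp [g]
  rw [Subalgebra.mem_center_iff]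
  intro y
  have hy : y ∈ S := by
    have := congrArg (fun f => f y) hid
    simp only [AlgHom.comp_apply, AlgHom.id_apply] at this
    rw [← this]
    exact (UniversalEnvelopingAlgebra.lift ℂ g y).2
  exact ((Subalgebra.mem_centralizer_iff ℂ).1 hy x rfl).symm

theorem E_mul_pow (N k : ℕ) (a b c d : Fin N) :
    E N a b * (Matrix.of (E N) ^ k) c d = (Matrix.of (E N) ^ k) c d * E N a b
      + (if b = c then (Matrix.of (E N) ^ k) a d else 0)
      - (if d = a then (Matrix.of (E N) ^ k) c b else 0) := by
  induction k generalizing c d with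
  | zero =>
    simp only [pow_zero, Matrix.one_apply]
    have h1 : (if b = c then if a = d then (1 : Ugl N) else 0 else 0)
        = if d = a then if c = b then 1 else 0 else 0 := by
      simp only [eq_comm (a := a) (b := d), eq_comm (a := b) (b := c)]
      split_ifs <;> rfl
    rw [h1, add_sub_cancel_right]
    by_cases h : c = d
    · rw [if_pos h, mul_one, one_mul]
    · rw [if_neg h, mul_zero, zero_mul]
  | succ k ih =>
    simp only [pow_succ, Matrix.mul_apply, Matrix.of_apply, Finset.mul_sum, Finset.sum_mul]
    have : ∀ e, E N a b * ((Matrix.of (E N) ^ k) c e * E N e d)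
        = (Matrix.of (E N) ^ k) c e * E N e d * E N a b
          + ((if b = e then (Matrix.of (E N) ^ k) c e * E N a d else 0)
            - (if e = a then (Matrix.of (E N) ^ k) c b * E N e d else 0))
          + (if b = c then (Matrix.of (E N) ^ k) a e * E N e d else 0)
          - (if d = a then (Matrix.of (E N) ^ k) c e * E N e b else 0) := by
      intro e
      rw [← mul_assoc, ih, sub_mul, add_mul, mul_assoc, E_mul_E]
      split_ifs <;> noncomm_ring
    rw [Finset.sum_congr rfl fun e _ => this e]
    simp only [Finset.sum_add_distrib, Finset.sum_sub_distrib]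
    have h1 : ∀ (p : Prop) [Decidable p] (f : Fin N → Ugl N),
        ∑ x, (if p then f x else 0) = if p then ∑ x, f x else 0 := by
      intro p _ f; split_ifs <;> simp
    simp [h1]

theorem sum_links (N k : ℕ) (g : Fin N → Fin N → Ugl N) :
    ∑ i : Fin (k + 1) → Fin N,
      (List.ofFn fun j : Fin k => E N (i j.castSucc) (i j.succ)).prod * g (i 0) (i (Fin.last k))
      = ∑ c, ∑ d, (Matrix.of (E N) ^ k) c d * g c d := by
  induction k generalizing g with
  | zero =>
    have : ∀ c, ∑ d, (Matrix.of (E N) ^ 0) c d * g c d = g c c := by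
      intro c; simp [Matrix.one_apply]
    simp only [this]
    simp only [List.ofFn_zero, List.prod_nil, one_mul]
    exact Fintype.sum_equiv (Equiv.funUnique (Fin 1) (Fin N)) _ _ (fun i => rfl)
  | succ k ih =>
    rw [← (Fin.snocEquiv fun _ : Fin (k + 2) => Fin N).sum_comp, Fintype.sum_prod_type_right]
    have := ih (fun c e => ∑ x, E N e x * g c x)
    trans ∑ c, ∑ e, (Matrix.of (E N) ^ k) c e * ∑ x, E N e x * g c x
    · rw [← this]
      refine Finset.sum_congr rfl fun i _ => ?_
      rw [Finset.mul_sum]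
      refine Finset.sum_congr rfl fun x _ => ?_
      have h0 : (Fin.snoc i x : Fin (k + 2) → Fin N) 0 = i 0 := by
        rw [← Fin.castSucc_zero, Fin.snoc_castSucc]
      simp only [Fin.snocEquiv_apply, List.ofFn_succ' (n := k), List.concat_eq_append,
        List.prod_append, List.prod_singleton, Fin.snoc_castSucc, Fin.succ_castSucc,
        Fin.succ_last, Fin.snoc_last, h0, mul_assoc]
    · refine Finset.sum_congr rfl fun c _ => ?_
      simp only [pow_succ, Matrix.mul_apply, Matrix.of_apply, Finset.mul_sum, Finset.sum_mul,
        mul_assoc]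
      rw [Finset.sum_comm]

theorem finRotate_castSucc (k : ℕ) (j : Fin k) : finRotate (k + 1) j.castSucc = j.succ := by
  rw [finRotate_apply, Fin.coeSucc_eq_succ]

theorem casimir_succ (N k : ℕ) :
    casimir N (k + 1) = ∑ c, (Matrix.of (E N) ^ (k + 1)) c c := by
  have := sum_links N k (fun c d => E N d c)
  simp only [pow_succ, Matrix.mul_apply, Matrix.of_apply]
  rw [← this, casimir, wglN]
  refine Finset.sum_congr rfl fun i _ => ?_
  rw [List.ofFn_succ', List.concat_eq_append, List.prod_append, List.prod_singleton]
  simp only [finRotate_castSucc, finRotate_last]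

theorem casimir_mem_center (N : ℕ) (m : ℕ+) :
    casimir N m ∈ Subalgebra.center ℂ (Ugl N) := by
  obtain ⟨k, hk⟩ : ∃ k, (m : ℕ) = k + 1 := ⟨m.natPred, by simp⟩
  rw [hk, casimir_succ]
  apply mem_center_of_commute
  intro a b
  simp only [Finset.mul_sum, Finset.sum_mul, E_mul_pow]
  simp [Finset.sum_sub_distrib, Finset.sum_add_distrib]

/-! ### The universal `gl`-weight system -/

/-- For `N = 1, 2, …`, the homomorphism from `ℂ[N][C_1, C_2, …]` to the center of `U gl(N)` which
sends the variable `N` (the polynomial variable `X` of the coefficient ring `ℂ[X]`) to the number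
`N` and the variable `C_m` to the Casimir element `C_m` of `U gl(N)`. -/
noncomputable def specialize (N : ℕ) :
    MvPolynomial ℕ+ ℂ[X] →+* Subalgebra.center ℂ (Ugl N) :=
  MvPolynomial.eval₂Hom
    ((algebraMap ℂ (Subalgebra.center ℂ (Ugl N))).comp (Polynomial.evalRingHom (N : ℂ)))
    (fun m => ⟨casimir N m, casimir_mem_center N m⟩)

/-- A family of elements of `U gl(N)` is uniform if it is given by a single polynomial. -/
def Uniform (F : ∀ N : ℕ, Ugl N) : Prop :=
  ∃ P : MvPolynomial ℕ+ ℂ[X], ∀ N : ℕ, 1 ≤ N → (specialize N P : Ugl N) = F N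

theorem Uniform.add {F G : ∀ N : ℕ, Ugl N} (hF : Uniform F) (hG : Uniform G) :
    Uniform fun N => F N + G N := by
  obtain ⟨P, hP⟩ := hF
  obtain ⟨Q, hQ⟩ := hG
  exact ⟨P + Q, fun N hN => by simp [hP N hN, hQ N hN]⟩

theorem Uniform.sub {F G : ∀ N : ℕ, Ugl N} (hF : Uniform F) (hG : Uniform G) :
    Uniform fun N => F N - G N := by
  obtain ⟨P, hP⟩ := hF
  obtain ⟨Q, hQ⟩ := hG
  exact ⟨P - Q, fun N hN => by simp [hP N hN, hQ N hN]⟩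

theorem Uniform.mul {F G : ∀ N : ℕ, Ugl N} (hF : Uniform F) (hG : Uniform G) :
    Uniform fun N => F N * G N := by
  obtain ⟨P, hP⟩ := hF
  obtain ⟨Q, hQ⟩ := hG
  exact ⟨P * Q, fun N hN => by simp [hP N hN, hQ N hN]⟩

theorem uniform_natCast_pow (k : ℕ) : Uniform fun N => (N : Ugl N) ^ k :=
  ⟨MvPolynomial.C (X ^ k), fun N _ => by simp [specialize]⟩

theorem uniform_casimir (k : ℕ) : Uniform fun N => casimir N (k + 1) :=
  ⟨MvPolynomial.X k.succPNat, fun N _ => by simp [specialize]⟩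

/-- The sum over all labellings `i : L → {1, …, N}` of the product of the matrix units
`E_{i(a) i(b)}` over the pairs `(a, b)` in a list. -/
noncomputable def wordSum (N : ℕ) {L : Type} [Fintype L] [DecidableEq L] (w : List (L × L)) :
    Ugl N :=
  ∑ i : L → Fin N, (w.map fun p => E N (i p.1) (i p.2)).prod

/-- Every label is the source of at most one pair, and the targets are the sources. -/
def Good {L : Type} (w : List (L × L)) : Prop :=
  (w.map Prod.fst).Perm (w.map Prod.snd) ∧ (w.map Prod.fst).Nodup

theorem Good.perm {L : Type} {w w' : List (L × L)} (h : Good w) (hp : w.Perm w') : Good w' :=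
  ⟨((hp.map _).symm.trans h.1).trans (hp.map _), (hp.map _).nodup_iff.1 h.2⟩

/-- Identify the label `c` with the label `b`. -/
def merge {L : Type} [DecidableEq L] (b c : L) (h : b ≠ c) (x : L) : {x : L // x ≠ c} :=
  if hx : x = c then ⟨b, h⟩ else ⟨x, hx⟩

theorem sum_merge (N : ℕ) {L : Type} [Fintype L] [DecidableEq L] (b c : L) (h : b ≠ c)
    (F : (L → Fin N) → Ugl N) :
    ∑ i : L → Fin N, (if i b = i c then F i else 0)
      = ∑ j : {x : L // x ≠ c} → Fin N, F (fun x => j (merge b c h x)) := by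
  rw [← Finset.sum_filter]
  refine Finset.sum_bij' (fun i _ x => i x.1) (fun j _ x => j (merge b c h x)) ?_ ?_ ?_ ?_ ?_
  · intros; simp
  · intro j _; simp [merge, h]
  · intro i hi
    funext x
    simp only [Finset.mem_filter, Finset.mem_univ, true_and] at hi
    by_cases hx : x = c
    · subst hx; simp [merge, hi]
    · simp [merge, hx]
  · intro j _
    funext x
    simp [merge, x.2]
  · intro i hi
    congr 1
    funext x
    simp only [Finset.mem_filter, Finset.mem_univ, true_and] at hi
    by_cases hx : x = c
    · subst hx; simp [merge, hi]
    · simp [merge, hx]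

/-- The induction hypothesis of `uniform_wordSum`. -/
def AllUniform (n : ℕ) : Prop :=
  ∀ (L : Type) [Fintype L] [DecidableEq L] (w : List (L × L)), Good w → w.length = n →
    Uniform fun N => wordSum N w

theorem uniform_delta {n : ℕ} (ih : AllUniform n) {L : Type} [Fintype L] [DecidableEq L]
    (b c : L) (v : List (L × L)) (hl : v.length = n)
    (hn : (c :: v.map Prod.fst).Nodup)
    (hp : (b :: v.map Prod.snd).Perm (c :: v.map Prod.fst)) :
    Uniform fun N => ∑ i : L → Fin N,
      if i b = i c then (v.map fun p => E N (i p.1) (i p.2)).prod else 0 := by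
  by_cases h : b = c
  · subst h
    simp only [if_true]
    exact ih L v ⟨(List.Perm.cons_inv hp).symm, (List.nodup_cons.1 hn).2⟩ hl
  · have := ih {x : L // x ≠ c} (v.map fun p => (merge b c h p.1, merge b c h p.2)) ?_ (by simpa)
    · convert this using 2 with N
      rw [sum_merge N b c h]
      simp [wordSum, Function.comp_def]
    · have e1 : merge b c h b = merge b c h c := by simp [merge, h]
      constructor
      · have := hp.map (merge b c h)
        simp only [List.map_cons, e1] at this
        have := (List.Perm.cons_inv this).symm
        simpa [Function.comp_def] using this
      · have h2 := List.nodup_cons.1 hn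
        have : ((v.map Prod.fst).map (merge b c h)).Nodup := by
          refine List.Nodup.map_on ?_ h2.2
          intro x hx y hy hxy
          have hxc : x ≠ c := fun e => h2.1 (e ▸ hx)
          have hyc : y ≠ c := fun e => h2.1 (e ▸ hy)
          simpa [merge, hxc, hyc] using hxy
        simpa [Function.comp_def] using this

theorem wordSum_swap (N : ℕ) {L : Type} [Fintype L] [DecidableEq L] (u v : List (L × L))
    (p q : L × L) :
    wordSum N (u ++ p :: q :: v) = wordSum N (u ++ q :: p :: v)
      + (∑ i : L → Fin N, if i p.2 = i q.1 then
          ((u ++ (p.1, q.2) :: v).map fun p => E N (i p.1) (i p.2)).prod else 0)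
      - (∑ i : L → Fin N, if i q.2 = i p.1 then
          ((u ++ (q.1, p.2) :: v).map fun p => E N (i p.1) (i p.2)).prod else 0) := by
  simp only [wordSum, ← Finset.sum_add_distrib, ← Finset.sum_sub_distrib]
  refine Finset.sum_congr rfl fun i _ => ?_
  simp only [List.map_append, List.map_cons, List.prod_append, List.prod_cons]
  rw [← mul_assoc (E N _ _) (E N _ _), E_mul_E]
  split_ifs <;> noncomm_ring

theorem uniform_swap {n : ℕ} (ih : AllUniform n) {L : Type} [Fintype L] [DecidableEq L]
    (u v : List (L × L)) (p q : L × L) (hg : Good (u ++ p :: q :: v))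
    (hl : (u ++ p :: q :: v).length = n + 1) (h : Uniform fun N => wordSum N (u ++ q :: p :: v)) :
    Uniform fun N => wordSum N (u ++ p :: q :: v) := by
  have hsw : (fun N => wordSum N (u ++ p :: q :: v)) = _ :=
    funext fun N => wordSum_swap N u v p q
  rw [hsw]
  obtain ⟨h1, h2⟩ := hg
  simp only [List.map_append, List.map_cons] at h1 h2
  refine (h.add (uniform_delta ih p.2 q.1 _ ?_ ?_ ?_)).sub (uniform_delta ih q.2 p.1 _ ?_ ?_ ?_)
  · simp at hl ⊢; omega
  · refine (List.Perm.nodup_iff ?_).1 h2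
    simp only [List.map_append, List.map_cons]
    rw [List.perm_iff_count]; intro x; simp [List.count_cons]; omega
  · refine List.Perm.trans (List.Perm.trans ?_ h1.symm) ?_
    all_goals
      simp only [List.map_append, List.map_cons]
      rw [List.perm_iff_count]; intro x; simp [List.count_cons]; omega
  · simp at hl ⊢; omega
  · refine (List.Perm.nodup_iff ?_).1 h2
    simp only [List.map_append, List.map_cons]
    rw [List.perm_iff_count]; intro x; simp [List.count_cons]; omega
  · refine List.Perm.trans (List.Perm.trans ?_ h1.symm) ?_
    all_goals
      simp only [List.map_append, List.map_cons]
      rw [List.perm_iff_count]; intro x; simp [List.count_cons]; omega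

theorem uniform_perm {n : ℕ} (ih : AllUniform n) {L : Type} [Fintype L] [DecidableEq L]
    {w w' : List (L × L)} (hp : w.Perm w') : ∀ u : List (L × L), Good (u ++ w) →
    (u ++ w).length = n + 1 → (Uniform fun N => wordSum N (u ++ w')) →
    Uniform fun N => wordSum N (u ++ w) := by
  induction hp with
  | nil => intro u _ _ h; exact h
  | cons x _ ih' =>
    intro u hg hl h
    have := ih' (u ++ [x])
    simp only [List.append_assoc, List.cons_append, List.nil_append] at this
    exact this hg hl h
  | swap x y l =>
    intro u hg hl h
    exact uniform_swap ih u l y x hg hl h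
  | trans p1 _ ih1 ih2 =>
    intro u hg hl h
    exact ih1 u hg hl (ih2 u (hg.perm (p1.append_left u))
      (by rw [← hl, (p1.append_left u).length_eq]) h)

theorem exists_cycle_aux {L : Type} [DecidableEq L] {w : List (L × L)} (hg : Good w) :
    ∀ (n : ℕ) (r : List (L × L)), r.length = n → ∀ (k : ℕ) (f : Fin (k + 1) → L),
    Function.Injective f → f (Fin.last k) ∈ w.map Prod.fst →
    w.Perm ((List.ofFn fun j : Fin k => (f j.castSucc, f j.succ)) ++ r) →
    ∃ (k : ℕ) (f : Fin (k + 1) → L) (r : List (L × L)), Function.Injective f ∧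
      w.Perm ((List.ofFn fun j => (f j, f (finRotate (k + 1) j))) ++ r) := by
  intro n
  induction n with
  | zero =>
    intro r hr k f hf hm hp
    obtain rfl := List.length_eq_zero_iff.1 hr
    have := ((hp.map Prod.fst).mem_iff).1 hm
    simp only [List.append_nil, List.map_ofFn, List.mem_ofFn', Set.mem_range,
      Function.comp_apply] at this
    obtain ⟨j, hj⟩ := this
    exact absurd (hf hj) (Fin.castSucc_lt_last j).ne
  | succ n ihn =>
    intro r hr k f hf hm hp
    have h1 := ((hp.map Prod.fst).mem_iff).1 hm
    rw [List.map_append, List.mem_append] at h1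
    rcases h1 with h1 | h1
    · simp only [List.map_ofFn, List.mem_ofFn', Set.mem_range, Function.comp_apply] at h1
      obtain ⟨j, hj⟩ := h1
      exact absurd (hf hj) (Fin.castSucc_lt_last j).ne
    · obtain ⟨⟨z, y⟩, hq, hz⟩ := List.mem_map.1 h1
      simp only at hz
      subst hz
      obtain ⟨r', hr'⟩ : ∃ r', r.Perm ((f (Fin.last k), y) :: r') :=
        ⟨_, List.perm_cons_erase hq⟩
      have hp' := hp.trans (hr'.append_left _)
      have htn : (w.map Prod.snd).Nodup := hg.1.nodup_iff.1 hg.2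
      by_cases hy : y = f 0
      · refine ⟨k, f, r', hf, hp'.trans (List.Perm.of_eq ?_)⟩
        rw [List.ofFn_succ', List.concat_eq_append]
        simp only [finRotate_castSucc, finRotate_last, hy, List.append_assoc, List.cons_append,
          List.nil_append]
      · have hyf : ∀ j, f j ≠ y := by
          intro j
          refine Fin.cases (Ne.symm hy) (fun j' hj => ?_) j
          have := ((hp'.map Prod.snd).nodup_iff).1 htn
          simp only [List.map_append, List.map_cons] at this
          rw [List.nodup_append] at this
          refine this.2.2 y ?_ y (by simp) rfl
          simp only [List.map_ofFn, List.mem_ofFn', Set.mem_range, Function.comp_apply]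
          exact ⟨j', hj⟩
        refine ihn r' ?_ (k + 1) (Fin.snoc f y) ?_ ?_ ?_
        · have := hr'.length_eq
          simp at this; omega
        · intro i j
          refine Fin.lastCases ?_ (fun i => ?_) i <;> refine Fin.lastCases ?_ (fun j => ?_) j
          · simp
          · simpa using fun h => absurd h.symm (hyf j)
          · simpa using fun h => absurd h (hyf i)
          · simpa using fun h => hf h
        · rw [Fin.snoc_last]
          refine hg.1.mem_iff.2 ((hp'.map Prod.snd).mem_iff.2 ?_)
          simp
        · refine hp'.trans (List.Perm.of_eq ?_)
          rw [List.ofFn_succ', List.concat_eq_append]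
          simp only [Fin.snoc_castSucc, Fin.succ_castSucc, Fin.succ_last, Fin.snoc_last,
            List.append_assoc, List.cons_append, List.nil_append]

theorem wordSum_factor (N : ℕ) {L : Type} [Fintype L] [DecidableEq L] (k : ℕ)
    (f : Fin (k + 1) → L) (hf : Function.Injective f)
    (r : List ({x : L // ¬ x ∈ Set.range f} × {x : L // ¬ x ∈ Set.range f})) :
    wordSum N ((List.ofFn fun j => (f j, f (finRotate (k + 1) j)))
        ++ r.map (Prod.map Subtype.val Subtype.val))
      = casimir N (k + 1) * wordSum N r := by
  classical
  rw [wordSum, ← (Equiv.piEquivPiSubtypeProd (· ∈ Set.range f) fun _ => Fin N).symm.sum_comp,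
    Fintype.sum_prod_type, casimir, wglN,
    ← (Equiv.arrowCongr (Equiv.ofInjective f hf) (Equiv.refl (Fin N))).symm.sum_comp, wordSum,
    Finset.sum_mul_sum]
  refine Finset.sum_congr rfl fun i _ => Finset.sum_congr rfl fun j _ => ?_
  rw [List.map_append, List.prod_append]
  congr 1
  · rw [List.map_ofFn]
    congr 2
    funext x
    simp [Equiv.piEquivPiSubtypeProd]
  · rw [List.map_map]
    congr 2
    funext p
    have h1 := p.1.2
    have h2 := p.2.2
    simp only [Set.mem_range] at h1 h2
    simp [Equiv.piEquivPiSubtypeProd, h1, h2]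

theorem uniform_wordSum (n : ℕ) : AllUniform n := by
  induction n using Nat.strong_induction_on with
  | _ n ih =>
    intro L _ _ w hg hl
    rcases w with _ | ⟨p, w⟩
    · convert uniform_natCast_pow (Fintype.card L) using 2 with N
      simp [wordSum]
    · obtain ⟨n, rfl⟩ : ∃ m, n = m + 1 := ⟨w.length, by simpa using hl.symm⟩
      obtain ⟨k, f, r, hf, hp⟩ := exists_cycle_aux hg _ (p :: w) rfl 0 (fun _ => p.1)
        (fun i j _ => by omega) (by simp) (by simp)
      refine uniform_perm (ih n (Nat.lt_succ_self n)) hp [] hg hl ?_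
      obtain ⟨h1, h2⟩ := hg.perm hp
      simp only [List.map_append, List.map_ofFn, Function.comp_def] at h1 h2
      have hcyc : (List.ofFn fun j => f (finRotate (k + 1) j)).Perm (List.ofFn f) :=
        Equiv.Perm.ofFn_comp_perm (finRotate (k + 1)) f
      have h3 : (r.map Prod.fst).Perm (r.map Prod.snd) :=
        (List.perm_append_left_iff _).1 (h1.trans (hcyc.append_right _))
      rw [List.nodup_append] at h2
      have hs : ∀ x ∈ r.map Prod.fst, x ∉ Set.range f := by
        rintro x hx ⟨j, rfl⟩
        exact h2.2.2 (f j) ((List.mem_ofFn' _ _).2 ⟨j, rfl⟩) _ hx rfl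
      have ht : ∀ x ∈ r.map Prod.snd, x ∉ Set.range f := fun x hx => hs x (h3.mem_iff.2 hx)
      obtain ⟨r', rfl⟩ : ∃ r' : List ({x : L // ¬ x ∈ Set.range f} × {x : L // ¬ x ∈ Set.range f}),
          r'.map (Prod.map Subtype.val Subtype.val) = r := by
        have : r ∈ Set.range (List.map (Prod.map
            (Subtype.val : {x : L // ¬ x ∈ Set.range f} → L)
            (Subtype.val : {x : L // ¬ x ∈ Set.range f} → L))) := by
          rw [Set.range_list_map]
          intro q hq
          exact ⟨(⟨q.1, hs _ (List.mem_map_of_mem hq)⟩, ⟨q.2, ht _ (List.mem_map_of_mem hq)⟩), rfl⟩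
        exact this
      simp only [List.nil_append, wordSum_factor _ k f hf]
      refine (uniform_casimir k).mul ?_
      have hlen := hp.length_eq
      simp at hlen
      simp at hl
      refine ih r'.length (by omega) _ r' ⟨?_, ?_⟩ rfl
      · rw [← List.map_perm_map_iff Subtype.val_injective]
        simpa [Function.comp_def] using h3
      · have := h2.2.1
        simp only [List.map_map] at this
        have h4 : (List.map Subtype.val (r'.map Prod.fst)).Nodup := by
          simpa [Function.comp_def] using this
        exact List.Nodup.of_map _ h4

theorem exists_wgl {m : ℕ} (α : Equiv.Perm (Fin m)) :
    ∃ P : MvPolynomial ℕ+ ℂ[X], ∀ N : ℕ, 1 ≤ N → (specialize N P : Ugl N) = wglN N α := by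
  have := uniform_wordSum m (Fin m) (List.ofFn fun k => (k, α k)) ⟨?_, ?_⟩ (by simp)
  · simpa [Uniform, wordSum, wglN, List.map_ofFn, Function.comp_def] using this
  · simp only [List.map_ofFn, Function.comp_def]
    exact (Equiv.Perm.ofFn_comp_perm α id).symm
  · simp only [List.map_ofFn, Function.comp_def]
    exact List.nodup_ofFn.2 fun _ _ h => h

/-- The universal `gl`-weight system `w_gl(α) ∈ ℂ[N][C_1, C_2, …]` of a permutation `α`: the
polynomial whose specialization to `U gl(N)` is the value `w_{gl(N)}(α)` of the
`gl(N)`-weight system, simultaneously for all `N = 1, 2, …`. (Such a polynomial is unique, since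
`C_1, …, C_N` are algebraically independent in `U gl(N)` for every `N`.) -/
noncomputable def wgl {m : ℕ} (α : Equiv.Perm (Fin m)) : MvPolynomial ℕ+ ℂ[X] :=
  (exists_wgl α).choose

theorem specialize_wgl {m : ℕ} (α : Equiv.Perm (Fin m)) (N : ℕ) (hN : 1 ≤ N) :
    (specialize N (wgl α) : Ugl N) = wglN N α :=
  (exists_wgl α).choose_spec N hN

/-- The substitution `C_m := c m` for `m = 1, 2, …` in a polynomial from `ℂ[N][C_1, C_2, …]`. -/
noncomputable def substituteC (c : ℕ+ → ℂ[X]) : MvPolynomial ℕ+ ℂ[X] →ₐ[ℂ[X]] ℂ[X] :=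
  MvPolynomial.aeval c

/-- The number `c(α)` of cycles of a permutation, fixed points being cycles of length one. -/
noncomputable def numCycles {m : ℕ} (α : Equiv.Perm (Fin m)) : ℕ :=
  Nat.card (Quotient (Equiv.Perm.SameCycle.setoid α))

/-! ### Chord diagrams, intersection graphs and graph invariants -/

/-- A chord diagram with `n` chords, presented as an arc diagram: the `2n` points on the oriented
circle are numbered in cyclic order starting from some base point, and the chords are encoded by
the involution without fixed points that exchanges the two ends of each chord. -/
structure ChordDiagram (n : ℕ) where
  pairing : Equiv.Perm (Fin (2 * n))
  involutive : ∀ i, pairing (pairing i) = i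
  fixedPointFree : ∀ i, pairing i ≠ i

/-- The chords of a chord diagram, as the unordered pairs of their ends. -/
def ChordDiagram.Chord {n : ℕ} (B : ChordDiagram n) : Type :=
  {p : Sym2 (Fin (2 * n)) // ∃ i, p = s(i, B.pairing i)}

instance {n : ℕ} (B : ChordDiagram n) : Finite B.Chord :=
  inferInstanceAs (Finite {p : Sym2 (Fin (2 * n)) // ∃ i, p = s(i, B.pairing i)})

/-- The intersection graph `γ(B)`: its vertices are the chords of `B`, and two of them are adjacent
if and only if the chords intersect, that is, if their ends alternate. -/
def ChordDiagram.intersectionGraph {n : ℕ} (B : ChordDiagram n) : SimpleGraph B.Chord :=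
  SimpleGraph.fromRel fun p q => ∃ i j, p.1 = s(i, B.pairing i) ∧ q.1 = s(j, B.pairing j) ∧
    i < j ∧ j < B.pairing i ∧ B.pairing i < B.pairing j

/-- An isomorphism invariant of finite simple graphs with values in `R`. -/
structure GraphInvariant (R : Type) where
  toFun : ∀ {V : Type} [Finite V], SimpleGraph V → R
  iso_inv : ∀ {V W : Type} [Finite V] [Finite W] (G : SimpleGraph V) (H : SimpleGraph W),
    Nonempty (G ≃g H) → toFun G = toFun H

/-- The graph invariant `G ↦ N^{|V(G)|}` with values in `ℂ[N]`. -/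
noncomputable def vertexInvariant : GraphInvariant ℂ[X] where
  toFun := fun {V} _ _ => X ^ Nat.card V
  iso_inv := fun _ _ ⟨e⟩ => by rw [Nat.card_congr e.toEquiv]

/-- For intersection graphs of chord diagrams, the graph invariant `f` is induced from the
`gl`-weight system under the substitution `C_m := c m`, `m = 1, 2, …`. -/
def IsInducedFromGl (f : GraphInvariant ℂ[X]) (c : ℕ+ → ℂ[X]) : Prop :=
  ∀ (n : ℕ) (B : ChordDiagram n), f.toFun B.intersectionGraph = substituteC c (wgl B.pairing)

end GlWeight

namespace GlWeight

/-! The trace kills commutators, so it extends to a character of `U gl(N)` with `E_{ij} ↦ δ_{ij}`.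
Applied to `w_{gl(N)}(α)`, it turns each word into the product of the `δ_{i_k, i_{α(k)}}`, so the
sum counts the labellings that are constant along the cycles of `α`: there are `N^{c(α)}` of them
(`traceChar_wglN`). A standard cycle has one orbit, so every Casimir element goes to `N`.

Hence the character composed with the specialization of `ℂ[N][C_1, C_2, …]` is the substitution `C_k
:= N` followed by evaluation at the number `N` (`traceChar_specialize`). The substituted polynomial
and `N^{c(α)}` therefore agree at every positive integer, so they are equal. For chord diagrams it
remains to see that the cycles of the pairing are the chords. -/

/-- The one-dimensional representation of `U gl(N)` given by the trace on `gl(N)`. -/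
noncomputable def traceChar (N : ℕ) : Ugl N →ₐ[ℂ] ℂ :=
  UniversalEnvelopingAlgebra.lift ℂ
    { Matrix.traceLinearMap (Fin N) ℂ ℂ with
      -- Both sides vanish: `tr(AB) = tr(BA)`, and `ℂ` is commutative.
      map_lie' := fun {A B} => by
        simp [Ring.lie_def, Matrix.trace_mul_comm A B, mul_comm] }

theorem traceChar_E (N : ℕ) (i j : Fin N) : traceChar N (E N i j) = if i = j then 1 else 0 := by
  unfold traceChar E
  rw [UniversalEnvelopingAlgebra.lift_ι_apply]
  change Matrix.trace (Matrix.single i j (1 : ℂ)) = _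
  split_ifs with h
  · subst h; simp
  · simp [Matrix.trace_single_eq_of_ne, h]

/-! ### Labellings constant along cycles -/

/-- Invariance under one step of `α` propagates to all integer powers. The codomain is arbitrary
because this serves both for labellings and, later, for the map from ends to chords. -/
theorem sameCycle_apply_eq {β γ : Type*} {α : Equiv.Perm β} {i : β → γ}
    (h : ∀ k, i k = i (α k)) {a b : β} (hab : α.SameCycle a b) : i a = i b := by
  have hz : ∀ (n : ℤ) (c : β), i ((α ^ n) c) = i c := by
    intro n
    induction n with
    | zero => simp
    | succ n ih => intro c; rw [zpow_add_one, Equiv.Perm.mul_apply, ih, ← h]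
    | pred n ih =>
      intro c
      -- After `ih` the goal is `i (α⁻¹ c) = i c`; using `h` forwards at `α⁻¹ c` closes it.
      rw [zpow_sub_one, Equiv.Perm.mul_apply, ih, h, ← Equiv.Perm.mul_apply, mul_inv_cancel,
        Equiv.Perm.one_apply]
  obtain ⟨n, rfl⟩ := hab
  exact (hz n a).symm

/-- The labellings that are constant along the cycles of `α` are the labellings of the set of
cycles of `α`. -/
def invariantLabellingEquiv {β : Type*} (γ : Type*) (α : Equiv.Perm β) :
    {i : β → γ // ∀ k, i k = i (α k)} ≃ (Quotient (Equiv.Perm.SameCycle.setoid α) → γ) where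
  toFun i := Quotient.lift i.1 fun _ _ h => sameCycle_apply_eq i.2 h
  invFun j := ⟨fun k => j ⟦k⟧, fun k => congrArg j
    (Quotient.sound (⟨1, by simp⟩ : α.SameCycle k (α k)))⟩
  left_inv _ := rfl
  right_inv j := by
    funext q
    induction q using Quotient.ind
    rfl

/-! ### Values of the trace character -/

theorem traceChar_wglN (N : ℕ) {m : ℕ} (α : Equiv.Perm (Fin m)) :
    traceChar N (wglN N α) = (N : ℂ) ^ numCycles α := by
  classical
  have h : ∀ i : Fin m → Fin N, traceChar N (List.ofFn fun k => E N (i k) (i (α k))).prod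
      = if ∀ k, i k = i (α k) then 1 else 0 := by
    intro i
    rw [map_list_prod, List.map_ofFn, List.prod_ofFn]
    simp only [Function.comp_apply, traceChar_E]
    rw [Finset.prod_ite_zero]
    simp
  rw [wglN, map_sum, Finset.sum_congr rfl fun i _ => h i, Finset.sum_boole,
    ← Fintype.card_subtype, ← Nat.card_eq_fintype_card,
    Nat.card_congr (invariantLabellingEquiv (Fin N) α), Nat.card_fun, Nat.card_fin, Nat.cast_pow,
    numCycles]

/-- The shift `k + 1` matters: the empty permutation has no cycles and would give `1` instead of
`N`. -/
theorem traceChar_casimir (N k : ℕ) : traceChar N (casimir N (k + 1)) = N := by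
  rw [casimir, traceChar_wglN]
  have : numCycles (finRotate (k + 1)) = 1 := by
    rw [numCycles, Nat.card_eq_one_iff_unique]
    refine ⟨⟨fun p q => ?_⟩, ⟨⟦0⟧⟩⟩
    induction p using Quotient.ind
    induction q using Quotient.ind
    rename_i a b
    -- Every point is reached from `0` by successive steps `c ↦ c + 1`, without the wrap-around.
    have h : ∀ c : Fin (k + 1), (finRotate (k + 1)).SameCycle 0 c := by
      intro c
      induction c using Fin.induction with
      | zero => exact Equiv.Perm.SameCycle.refl _ _
      | succ c ih => rw [← finRotate_castSucc]; exact Equiv.Perm.sameCycle_apply_right.2 ih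
    exact Quotient.sound ((h a).symm.trans (h b))
  rw [this, pow_one]

/-! ### From numbers `N` to polynomials in `N` -/

/-- Substituting `C_k := N` amounts to applying the trace character. -/
theorem traceChar_specialize (N : ℕ) (P : MvPolynomial ℕ+ ℂ[X]) :
    traceChar N (specialize N P) = (substituteC (fun _ => (X : ℂ[X])) P).eval (N : ℂ) := by
  have : ((traceChar N).toRingHom.comp (Subalgebra.center ℂ (Ugl N)).val.toRingHom).comp
        (specialize N)
      = (Polynomial.evalRingHom (N : ℂ)).comp (substituteC fun _ => (X : ℂ[X])).toRingHom := by
    -- It suffices to compare coefficients, where `p ↦ p(N)` on both sides, and variables, where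
    -- `C_m ↦ N`.
    apply MvPolynomial.ringHom_ext
    · intro p
      simp [specialize, substituteC]
    · intro m
      have := traceChar_casimir N m.natPred
      rw [PNat.natPred_add_one] at this
      simp [specialize, substituteC, this]
  exact RingHom.congr_fun this P

/-- Only the specialization property of `wgl` enters, so the value does not depend on which
polynomial with that property was chosen. -/
theorem substituteC_wgl {m : ℕ} (α : Equiv.Perm (Fin m)) :
    substituteC (fun _ => (X : ℂ[X])) (wgl α) = (X : ℂ[X]) ^ numCycles α := by
  -- The sample points are `n + 1` because `wgl` is tied to `U gl(N)` only for `N ≥ 1`.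
  refine Polynomial.eq_of_infinite_eval_eq _ _
    (Set.Infinite.mono (s := (fun n : ℕ => ((n + 1 : ℕ) : ℂ)) '' Set.univ) ?_ ?_)
  · rintro _ ⟨n, -, rfl⟩
    have h := traceChar_specialize (n + 1) (wgl α)
    rw [specialize_wgl α (n + 1) (by omega), traceChar_wglN] at h
    simp only [Set.mem_ofPred_eq, eval_pow, eval_X]
    exact h.symm
  · refine Set.infinite_univ.image fun a _ b _ h => ?_
    exact Nat.succ_injective (Nat.cast_injective h)

/-! ### Chords as cycles -/

/-- For an involution, the unordered pair of a point and its image is invariant along cycles;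
conversely, two ends of one chord differ by at most one step. -/
theorem ChordDiagram.sameCycle_iff {n : ℕ} (B : ChordDiagram n) (i j : Fin (2 * n)) :
    B.pairing.SameCycle i j ↔ s(i, B.pairing i) = s(j, B.pairing j) := by
  constructor
  · refine sameCycle_apply_eq (i := fun k => s(k, B.pairing k)) fun k => ?_
    simp only [B.involutive, Sym2.eq_swap]
  · intro h
    rcases Sym2.eq_iff.1 h with ⟨rfl, -⟩ | ⟨-, rfl⟩
    · exact Equiv.Perm.SameCycle.refl _ _
    · exact ⟨1, by simp⟩

/-- The chords are the cycles of the involution exchanging the ends of each chord. -/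
theorem ChordDiagram.card_chord {n : ℕ} (B : ChordDiagram n) :
    Nat.card B.Chord = numCycles B.pairing := by
  refine (Nat.card_congr (Equiv.ofBijective (Quotient.lift
    (fun i => (⟨s(i, B.pairing i), i, rfl⟩ : B.Chord))
    fun i j h => Subtype.ext ((B.sameCycle_iff i j).1 h)) ⟨?_, ?_⟩)).symm
  · intro p q
    induction p using Quotient.ind
    induction q using Quotient.ind
    exact fun h => Quotient.sound ((B.sameCycle_iff _ _).2 (congrArg Subtype.val h))
  · rintro ⟨_, i, rfl⟩
    exact ⟨⟦i⟧, rfl⟩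

end GlWeight

theorem mainTheorem8 :
    (∀ (m : ℕ) (α : Equiv.Perm (Fin m)),
      GlWeight.substituteC (fun _ => (X : ℂ[X])) (GlWeight.wgl α)
        = (X : ℂ[X]) ^ GlWeight.numCycles α) ∧
    GlWeight.IsInducedFromGl GlWeight.vertexInvariant (fun _ => (X : ℂ[X])) := by
  refine ⟨fun m α => GlWeight.substituteC_wgl α, fun n B => ?_⟩
  rw [GlWeight.substituteC_wgl, ← B.card_chord]
  -- The invariant sees only the vertex set, which is the set of chords; adjacency plays no role.
  rfl
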